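/- Let $V,W\colon\mathbb R\to\mathbb R$ be non-negative functions such that: * $W\in C^2(\mathbb R)$ is even, $W'$ and $W''$ are bounded, $W'\in L^1(\mathbb R)$, and $\inf_{x} W''(x)=-C_W$ with $C_W>0$; * $V(x)=\frac{\alpha}{2}x^2+\widetilde V(x)$ with $\alpha>0$, $\alpha+\inf_x\widetilde V''(x)=C_V>0$ and $C_V-C_W>0$, where either $\widetilde V=0$, or $\widetilde V$ is even, has polynomial growth, and for some integer $J\ge 2$ one has $\widetilde V\in C^J(\mathbb R)\setminus C^{J+1}(\mathbb R)$ and $\sup_x|\widetilde V^{(j)}(x)|<\infty$ for $2\le j\le J$. Let $\pi$ be an invariant density of the associated McKean–Vlasov equation, that is, a probability density on $\mathbb R$ with $$\pi(x)=\frac1{Z_\pi}\exp\bigl(-2V(x)-(W\star\pi)(x)\bigr),\qquad Z_\pi=\int_{\mathbb R}\exp\bigl(-2V(x)-(W\star\pi)(x)\bigr)\,dx<\infty ,$$ where $(W\star\pi)(x)=\int_{\mathbb R}W(x-y)\pi(y)\,dy$, and let $\mathcal F(\pi)(z)=\int_{\mathbb R}e^{izx}\pi(x)\,dx$ for $z\in\mathbb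 C$. Let $(a_j)_j$ be the (finite or infinite) family of zeros of $\mathcal F(\pi)$, listed with multiplicity. Put $$\rho=\inf\{m\ge 0:\ \mathcal F(\pi)(z)=O(\exp(|z|^m))\text{ as }z\to\infty\},\qquad \rho_1=\inf\Bigl\{r>0:\ \sum_j|a_j|^{-r}<\infty\Bigr\},$$ and assume that either $\rho_1<\rho$ or $\rho_1=\rho<2$. Let $E_1(z)=(1-z)e^{z}$. Then there exist $p_1\in\mathbb R$ and $p_2\ge 0$ such that for all $z\in\mathbb C$ the product $\prod_j E_1(z/a_j)$ converges unconditionally and $$\mathcal F(\pi)(z)=\exp\bigl(-p_2z^2+\mathrm i\,p_1z\bigr)\prod_{j}E_1\Bigl(\frac{z}{a_j}\Bigr).$$ -/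

import Mathlib

namespace McKeanVlasov

/-- Non-smooth confinement perturbation: `U` is even, has polynomial growth, and for some `J ≥ 2`
it is of class `C^J` but not of class `C^(J+1)`, with bounded derivatives of the orders
`2, …, J`. -/
structure IsNonsmoothPerturbation (U : ℝ → ℝ) : Prop where
  even : ∀ x, U (-x) = U x
  polynomial_growth : ∃ (C : ℝ) (k : ℕ), ∀ x, |U x| ≤ C * (1 + |x|) ^ k
  smoothness : ∃ J : ℕ, 2 ≤ J ∧ ContDiff ℝ (J : ℕ∞) U ∧ ¬ ContDiff ℝ ((J + 1 : ℕ) : ℕ∞) U ∧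
    ∀ j : ℕ, 2 ≤ j → j ≤ J → ∃ M : ℝ, ∀ x, |iteratedDeriv j U x| ≤ M

/-- The standing assumption on the confinement potential `V = α x² / 2 + U` and on the interaction
potential `W`, with `C_W = - inf W''` and `C_V = α + inf U''`. -/
structure PotentialAssumption (V W U : ℝ → ℝ) (α C_V C_W : ℝ) : Prop where
  V_nonneg : ∀ x, 0 ≤ V x
  W_nonneg : ∀ x, 0 ≤ W x
  W_contDiff : ContDiff ℝ 2 W
  W_even : ∀ x, W (-x) = W x
  W_deriv_bounded : ∃ M : ℝ, ∀ x, |deriv W x| ≤ M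
  W_deriv_integrable : MeasureTheory.Integrable (deriv W)
  W_deriv2_bounded : ∃ M : ℝ, ∀ x, |iteratedDeriv 2 W x| ≤ M
  C_W_pos : 0 < C_W
  C_W_spec : IsGLB (Set.range (iteratedDeriv 2 W)) (-C_W)
  α_pos : 0 < α
  V_eq : ∀ x, V x = α / 2 * x ^ 2 + U x
  C_V_pos : 0 < C_V
  C_V_spec : IsGLB (Set.range (iteratedDeriv 2 U)) (C_V - α)
  C_W_lt_C_V : 0 < C_V - C_W
  perturbation : (∀ x, U x = 0) ∨ IsNonsmoothPerturbation U

/-- The convolution `(W ⋆ π)(x) = ∫ W(x - y) π(y) dy`. -/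
noncomputable def conv (W π : ℝ → ℝ) (x : ℝ) : ℝ := ∫ y, W (x - y) * π y

/-- The unnormalized weight `exp(-2 V - W ⋆ π)`. -/
noncomputable def weight (V W π : ℝ → ℝ) (x : ℝ) : ℝ := Real.exp (-2 * V x - conv W π x)

/-- `π` is an invariant density of the McKean-Vlasov equation: a probability density with
`π = exp(-2 V - W ⋆ π) / Z`, where `Z = ∫ exp(-2 V - W ⋆ π) < ∞`. -/
structure IsInvariantDensity (V W π : ℝ → ℝ) : Prop where
  nonneg : ∀ x, 0 ≤ π x
  integrable : MeasureTheory.Integrable π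
  integral_eq_one : ∫ x, π x = 1
  weight_integrable : MeasureTheory.Integrable (weight V W π)
  eq_gibbs : ∀ x, π x = 1 / (∫ y, weight V W π y) * weight V W π x

/-- The Fourier transform `z ↦ ∫ exp(i z x) π(x) dx` on the complex plane. -/
noncomputable def cfourier (π : ℝ → ℝ) (z : ℂ) : ℂ :=
  ∫ x : ℝ, Complex.exp (Complex.I * z * (x : ℂ)) * (π x : ℂ)

/-- The order of an entire function: the infimum of all `m` with `f(z) = O(exp(|z|^m))` as
`z → ∞` (it is `∞` if there is no such `m`). -/
noncomputable def order (f : ℂ → ℂ) : ENNReal :=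
  ⨅ (m : NNReal) (_ : f =O[Bornology.cobounded ℂ] fun z : ℂ => Real.exp (‖z‖ ^ (m : ℝ))),
    (m : ENNReal)

/-- Index set for the zeros of `f` listed with multiplicity: a zero of multiplicity `k` has
exactly `k` indices. -/
abbrev ZeroIndex (f : ℂ → ℂ) : Type :=
  Σ w : {w : ℂ // f w = 0}, Fin (analyticOrderNatAt f (w : ℂ))

/-- The zero carried by an index. -/
def zero (f : ℂ → ℂ) (j : ZeroIndex f) : ℂ := (j.1 : ℂ)

/-- The critical exponent of convergence `inf {r > 0 | ∑ 1 / |a_j|^r < ∞}` of the zeros `a_j` of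
`f`, counted with multiplicity, for `f` with `f 0 ≠ 0`. -/
noncomputable def zeroExponent (f : ℂ → ℂ) : ENNReal :=
  ⨅ (r : NNReal) (_ : 0 < r ∧ Summable fun j : ZeroIndex f => 1 / ‖zero f j‖ ^ (r : ℝ)),
    (r : ENNReal)

/-- The growth assumption: `ρ₁ < ρ`, or `ρ₁ = ρ < 2`. -/
def GrowthAssumption (f : ℂ → ℂ) : Prop :=
  zeroExponent f < order f ∨ (zeroExponent f = order f ∧ order f < 2)

/-- The Hadamard canonical factor `E₁(z) = (1 - z) exp z`. -/
noncomputable def E₁ (z : ℂ) : ℂ := (1 - z) * Complex.exp z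

end McKeanVlasov

namespace McKeanVlasov

open Complex Real Filter Topology Metric

/-! The density `π` is dominated by a Gaussian, so `cfourier π` is entire and bounded by `exp (C (1
+ |z|²))`. Its order is thus at most two, and either growth alternative forces `∑ |a_j|⁻ˢ < ∞` for
some `1 ≤ s < 2`. The genus-one product `P` over the zeros then converges, grows at most like `exp
(C |z|ˢ)`, and has the same orders of vanishing, so `cfourier π = exp q * P` with `q` entire.

Jensen's formula bounds the circle means of `|log |f||` and `|log |P||`, hence of `|Re q|`, by `O(1
+ R²)`; this kills all Taylor coefficients of `q` beyond the second
(`iteratedDeriv_eq_zero_of_growth`) without a minimum modulus estimate. So `q = a z + b z²`.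

Since `π` is real, `cfourier π` is invariant under `z ↦ conj (f (-conj z))`; with `P' 0 = 0` this
makes `a` imaginary, and the same coefficient lemma applied to `P` makes `b` real. Finally `∫
cosh(yx) π ≥ 1` prevents decay at both `iy` and `-iy`, so `b ≤ 0`. -/

/-! ### Jensen's formula and Taylor coefficients of a logarithm -/

theorem log_norm_le_circleAverage {f : ℂ → ℂ} (hf : Differentiable ℂ f) (h0 : f 0 ≠ 0) {R : ℝ}
    (hR : 0 < R) : Real.log ‖f 0‖ ≤ circleAverage (fun z => Real.log ‖f z‖) 0 R := by
  have hfa : AnalyticOnNhd ℂ f (closedBall 0 |R|) := fun z _ => hf.analyticAt z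
  rw [AnalyticOnNhd.circleAverage_log_norm hR.ne' hfa h0]
  -- In Jensen's formula each zero `u` of the disc contributes its multiplicity times `log (R / |u|)
  -- ≥ 0`.
  refine le_add_of_nonneg_left (finsum_nonneg fun u => ?_)
  by_cases hu : u ∈ closedBall (0 : ℂ) |R|
  · refine mul_nonneg ?_ ?_
    · exact_mod_cast (MeromorphicOn.AnalyticOnNhd.divisor_nonneg hfa) u
    · rcases eq_or_ne u 0 with rfl | hu0
      · simp
      · rw [mem_closedBall, dist_zero_right, abs_of_pos hR] at hu
        rw [zero_sub, norm_neg]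
        refine Real.log_nonneg ?_
        rw [← div_eq_mul_inv, le_div_iff₀ (norm_pos_iff.2 hu0)]
        simpa using hu
  · rw [Function.locallyFinsuppWithin.apply_eq_zero_of_notMem _ hu]
    simp

theorem circleIntegrable_log_norm_of_differentiable {f : ℂ → ℂ} (hf : Differentiable ℂ f) (R : ℝ) :
    CircleIntegrable (fun z => Real.log ‖f z‖) 0 R :=
  MeromorphicOn.circleIntegrable_log_norm fun z _ => (hf.analyticAt z).meromorphicAt

/-- From `t ≤ B` and `0 ≤ B` follows `|t| ≤ 2B - t`, and Jensen bounds the mean of `t = log |f|`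
below. An upper growth bound thereby controls the negative part too, despite the zeros. -/
theorem circleAverage_abs_log_norm_le {f : ℂ → ℂ} (hf : Differentiable ℂ f) (h0 : f 0 ≠ 0) {R B : ℝ}
    (hR : 0 < R) (hB : 0 ≤ B) (hfB : ∀ z ∈ sphere (0 : ℂ) R, ‖f z‖ ≤ Real.exp B) :
    circleAverage (fun z => |Real.log ‖f z‖|) 0 R ≤ 2 * B - Real.log ‖f 0‖ := by
  have hint := circleIntegrable_log_norm_of_differentiable hf R
  have hconst : CircleIntegrable (fun _ : ℂ => 2 * B) 0 R := circleIntegrable_const _ _ _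
  calc circleAverage (fun z => |Real.log ‖f z‖|) 0 R
      ≤ circleAverage (fun z => 2 * B - Real.log ‖f z‖) 0 R := by
        refine circleAverage_mono hint.abs (hconst.sub hint) fun z hz => ?_
        rw [abs_of_pos hR] at hz
        have hle : Real.log ‖f z‖ ≤ B := by
          rcases eq_or_ne (f z) 0 with h | h
          · simpa [h] using hB
          · exact (Real.log_le_iff_le_exp (norm_pos_iff.2 h)).2 (hfB z hz)
        rcases abs_cases (Real.log ‖f z‖) with h | h <;> linarith [h.1]
    _ = 2 * B - circleAverage (fun z => Real.log ‖f z‖) 0 R := by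
        rw [circleAverage_fun_sub hconst hint, circleAverage_const]
    _ ≤ _ := by linarith [log_norm_le_circleAverage hf h0 hR]

theorem norm_circleAverage_le (f : ℂ → ℂ) (c : ℂ) (R : ℝ) :
    ‖circleAverage f c R‖ ≤ circleAverage (fun z => ‖f z‖) c R := by
  rw [circleAverage, circleAverage, norm_smul, smul_eq_mul, Real.norm_of_nonneg (by positivity)]
  gcongr
  exact intervalIntegral.norm_integral_le_integral_norm Real.two_pi_pos.le

theorem circleAverage_inv_pow_mul {q : ℂ → ℂ} (hq : Differentiable ℂ q) {R : ℝ} (hR : 0 < R)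
    (n : ℕ) :
    circleAverage (fun z => (z ^ n)⁻¹ * q z) 0 R = iteratedDeriv n q 0 / (n.factorial : ℂ) := by
  rw [circleAverage_eq_circleIntegral hR.ne']
  have := DiffContOnCl.circleIntegral_one_div_sub_center_pow_smul (c := (0 : ℂ)) hR n
    (hq.diffContOnCl (s := ball 0 R))
  have h2 : (∮ z in C(0, R), (z - 0)⁻¹ • ((z ^ n)⁻¹ * q z)) =
      ∮ z in C(0, R), (1 / (z - 0) ^ (n + 1)) • q z := by
    congr 1
    ext z
    simp only [sub_zero, smul_eq_mul, one_div, pow_succ, mul_inv]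
    ring
  rw [h2, this, smul_smul, smul_eq_mul]
  have : (2 * π * I : ℂ) ≠ 0 := two_pi_I_ne_zero
  field_simp

/-- On the circle `z⁻ⁿ conj q = R⁻²ⁿ conj (zⁿ q)`, which has mean zero for `n ≠ 0`. Adding it to
`z⁻ⁿ q` in Cauchy's formula replaces `q` by `2 Re q`. -/
theorem norm_iteratedDeriv_le_circleAverage_re {q : ℂ → ℂ} (hq : Differentiable ℂ q) {R : ℝ}
    (hR : 0 < R) {n : ℕ} (hn : n ≠ 0) :
    ‖iteratedDeriv n q 0‖ / n.factorial * R ^ n ≤ 2 * circleAverage (fun z => |(q z).re|) 0 R := by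
  have hqc := hq.continuous
  have hzero : ∀ z ∈ sphere (0 : ℂ) R, z ≠ 0 := by
    rintro z hz rfl
    simp at hz
    exact hR.ne hz
  have hci1 : CircleIntegrable (fun z => (z ^ n)⁻¹ * q z) 0 R := by
    refine ContinuousOn.circleIntegrable hR.le (ContinuousOn.mul ?_ hqc.continuousOn)
    exact ContinuousOn.inv₀ (by fun_prop) fun z hz => pow_ne_zero _ (hzero z hz)
  have hci2 : CircleIntegrable (fun z => z ^ n * q z) 0 R :=
    Continuous.continuousOn (by fun_prop) |>.circleIntegrable hR.le
  have hci3 : CircleIntegrable (fun z => (R ^ (2 * n) : ℝ)⁻¹ • (starRingEnd ℂ) (z ^ n * q z)) 0 R :=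
    Continuous.continuousOn (by fun_prop) |>.circleIntegrable hR.le
  have h1 := circleAverage_inv_pow_mul hq hR n
  have h2 : circleAverage (fun z => z ^ n * q z) 0 R = 0 := by
    have hd : Differentiable ℂ fun z : ℂ => z ^ n * q z := by fun_prop
    rw [DiffContOnCl.circleAverage hd.diffContOnCl]
    simp [hn]
  have h3 : circleAverage (fun z => (R ^ (2 * n) : ℝ)⁻¹ • (starRingEnd ℂ) (z ^ n * q z)) 0 R = 0 := by
    rw [circleAverage_fun_smul]
    have := ContinuousLinearMap.circleAverage_comp_comm (Complex.conjCLE : ℂ →L[ℝ] ℂ) hci2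
    rw [h2, map_zero] at this
    have h4 : circleAverage (fun z => (starRingEnd ℂ) (z ^ n * q z)) 0 R = 0 := this
    rw [h4, smul_zero]
  have h4 : circleAverage (fun z => (z ^ n)⁻¹ * (2 * (q z).re : ℂ)) 0 R =
      iteratedDeriv n q 0 / (n.factorial : ℂ) := by
    have hadd := circleAverage_fun_add hci1 hci3
    rw [h3, add_zero, h1] at hadd
    rw [← hadd]
    refine circleAverage_congr_sphere fun z hz => ?_
    rw [abs_of_pos hR] at hz
    have hz0 := hzero z hz
    have hzR : z * (starRingEnd ℂ) z = (R : ℂ) ^ 2 := by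
      rw [Complex.mul_conj, Complex.normSq_eq_norm_sq]
      simp at hz
      simp [hz]
    have hq2 : (2 * (q z).re : ℂ) = q z + (starRingEnd ℂ) (q z) := by
      rw [Complex.add_conj]; push_cast; ring
    have hRn : (R : ℂ) ≠ 0 := by exact_mod_cast hR.ne'
    have hc : ((starRingEnd ℂ) z) ^ n = ((R : ℂ) ^ (2 * n)) * (z ^ n)⁻¹ := by
      rw [pow_mul, ← hzR, mul_pow]; field_simp
    simp only [hq2, Complex.real_smul, map_mul, map_pow, hc]
    push_cast
    field_simp
  have h5 := norm_circleAverage_le (fun z => (z ^ n)⁻¹ * (2 * (q z).re : ℂ)) 0 R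
  rw [h4, norm_div, Complex.norm_natCast] at h5
  have h6 : circleAverage (fun z => ‖(z ^ n)⁻¹ * (2 * (q z).re : ℂ)‖) 0 R =
      (2 * (R ^ n)⁻¹) • circleAverage (fun z => |(q z).re|) 0 R := by
    rw [← circleAverage_fun_smul]
    refine circleAverage_congr_sphere fun z hz => ?_
    rw [abs_of_pos hR] at hz
    simp at hz
    simp [hz]
    ring
  rw [h6, smul_eq_mul] at h5
  have hRn : 0 < R ^ n := by positivity
  calc _ ≤ 2 * (R ^ n)⁻¹ * circleAverage (fun z => |(q z).re|) 0 R * R ^ n := by gcongr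
    _ = _ := by field_simp

/-- If a nonvanishing entire function `exp q` is a quotient of entire functions of growth at most
`exp (C (1 + |z|^s))`, then the Taylor coefficients of `q` of order larger than `s` vanish. -/
theorem iteratedDeriv_eq_zero_of_growth {F G q : ℂ → ℂ} (hF : Differentiable ℂ F)
    (hG : Differentiable ℂ G) (hq : Differentiable ℂ q) (hF0 : F 0 ≠ 0)
    (hFG : ∀ z, F z = Complex.exp (q z) * G z) {C s : ℝ} (hC : 0 ≤ C)
    (hFs : ∀ z, ‖F z‖ ≤ Real.exp (C * (1 + ‖z‖ ^ s)))
    (hGs : ∀ z, ‖G z‖ ≤ Real.exp (C * (1 + ‖z‖ ^ s))) {n : ℕ} (hn : n ≠ 0) (hsn : s < n) :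
    iteratedDeriv n q 0 = 0 := by
  have hG0 : G 0 ≠ 0 := fun h => hF0 (by rw [hFG, h, mul_zero])
  set K := |Real.log ‖F 0‖| + |Real.log ‖G 0‖|
  have key : ∀ R : ℝ, 0 < R → ‖iteratedDeriv n q 0‖ / n.factorial ≤
      2 * ((4 * C + K) * R ^ (-(n : ℝ)) + 4 * C * R ^ (-((n : ℝ) - s))) := by
    intro R hR
    have h1 := norm_iteratedDeriv_le_circleAverage_re hq hR hn
    have hiF := circleIntegrable_log_norm_of_differentiable hF R
    have hiG := circleIntegrable_log_norm_of_differentiable hG R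
    have hB : 0 ≤ C * (1 + R ^ s) := by positivity
    have h2 := circleAverage_abs_log_norm_le hF hF0 hR hB fun z hz => by
      have : ‖z‖ = R := by simpa using hz
      simpa [this] using hFs z
    have h3 := circleAverage_abs_log_norm_le hG hG0 hR hB fun z hz => by
      have : ‖z‖ = R := by simpa using hz
      simpa [this] using hGs z
    have h4 : circleAverage (fun z => |(q z).re|) 0 R =
        circleAverage (fun z => |Real.log ‖F z‖ - Real.log ‖G z‖|) 0 R := by
      -- `Re q = log |F| - log |G|` holds only off the zeros of `G`, a discrete set that circle
      -- averages ignore.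
      refine circleAverage_congr_codiscreteWithin ?_ hR.ne'
      have hcod : G ⁻¹' {0}ᶜ ∈ codiscrete ℂ :=
        AnalyticOnNhd.preimage_zero_mem_codiscrete (x := 0) (fun z _ => hG.analyticAt z) hG0
      refine Filter.codiscreteWithin_mono (Set.subset_univ _) ?_
      filter_upwards [hcod] with z hz
      have hz : G z ≠ 0 := hz
      rw [hFG z, norm_mul, Real.log_mul (by simp) (by simpa using hz), Complex.norm_exp,
        Real.log_exp]
      simp
    have h5 : circleAverage (fun z => |Real.log ‖F z‖ - Real.log ‖G z‖|) 0 R ≤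
        circleAverage (fun z => |Real.log ‖F z‖| + |Real.log ‖G z‖|) 0 R :=
      circleAverage_mono (hiF.sub hiG).abs (hiF.abs.add hiG.abs) fun z _ => abs_sub _ _
    have hadd : circleAverage (fun z => |Real.log ‖F z‖| + |Real.log ‖G z‖|) 0 R = _ :=
      circleAverage_fun_add hiF.abs hiG.abs
    rw [hadd] at h5
    have h6 : ‖iteratedDeriv n q 0‖ / n.factorial * R ^ n ≤
        2 * ((4 * C + K) + 4 * C * R ^ s) := by
      have := neg_abs_le (Real.log ‖F 0‖)
      have := neg_abs_le (Real.log ‖G 0‖)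
      simp only [K]
      linarith
    have hRn : 0 < R ^ n := by positivity
    rw [← le_div_iff₀ hRn] at h6
    refine h6.trans_eq ?_
    rw [neg_sub, Real.rpow_sub hR, Real.rpow_neg hR.le, Real.rpow_natCast]
    field_simp
  have hlim : Tendsto (fun R : ℝ => 2 * ((4 * C + K) * R ^ (-(n : ℝ)) +
      4 * C * R ^ (-((n : ℝ) - s)))) atTop (𝓝 (2 * ((4 * C + K) * 0 + 4 * C * 0))) := by
    have hn' : 0 < (n : ℝ) := by positivity
    exact (((tendsto_rpow_neg_atTop hn').const_mul _).add
      ((tendsto_rpow_neg_atTop (sub_pos.2 hsn)).const_mul _)).const_mul _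
  have hle := ge_of_tendsto hlim (eventually_atTop.2 ⟨1, fun R hR => key R (by linarith)⟩)
  have hle' : ‖iteratedDeriv n q 0‖ / n.factorial ≤ 0 := by simpa using hle
  have hf : (0 : ℝ) < n.factorial := by positivity
  rw [div_le_iff₀ hf, zero_mul] at hle'
  exact norm_le_zero_iff.1 hle'

/-- An entire function whose Taylor coefficients of order at least three vanish is quadratic. -/
theorem eq_quadratic_of_iteratedDeriv_eq_zero {q : ℂ → ℂ} (hq : Differentiable ℂ q)
    (h : ∀ n, 3 ≤ n → iteratedDeriv n q 0 = 0) (z : ℂ) :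
    q z = q 0 + iteratedDeriv 1 q 0 * z + iteratedDeriv 2 q 0 / 2 * z ^ 2 := by
  rw [← Complex.taylorSeries_eq_of_entire' 0 z hq, tsum_eq_sum (s := Finset.range 3)]
  · simp only [Finset.sum_range_succ, Finset.sum_range_zero, Nat.factorial, iteratedDeriv_zero,
      sub_zero]
    push_cast
    ring
  · intro n hn
    rw [h n (by simpa using hn)]
    simp

/-! ### Holomorphic logarithms and division of entire functions -/

/-- A nonvanishing entire function has a holomorphic logarithm. -/
theorem exists_differentiable_exp_eq {Q : ℂ → ℂ} (hQ : Differentiable ℂ Q) (h0 : ∀ z, Q z ≠ 0) :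
    ∃ q : ℂ → ℂ, Differentiable ℂ q ∧ ∀ z, Q z = Complex.exp (q z) := by
  have hd : Differentiable ℂ fun z => deriv Q z / Q z :=
    Differentiable.div (hQ.contDiff.differentiable_deriv_two) hQ h0
  obtain ⟨q, hq0, hq⟩ := hd.isExactOn_univ.with_val_at 0 (Complex.log (Q 0))
  have hqd : Differentiable ℂ q := fun z => (hq z (Set.mem_univ z)).differentiableAt
  refine ⟨q, hqd, fun z => ?_⟩
  have hconst : ∀ z, deriv (fun z => Q z * Complex.exp (-q z)) z = 0 := fun z => by
    have := ((hQ z).hasDerivAt.mul ((hq z (Set.mem_univ z)).neg.cexp)).deriv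
    refine Eq.trans this ?_
    field_simp [h0 z]
    ring
  have hdd : Differentiable ℂ fun z => Q z * Complex.exp (-q z) := by fun_prop
  have := is_const_of_deriv_eq_zero hdd hconst z 0
  simp only [hq0, Complex.exp_neg, Complex.exp_log (h0 0), mul_inv_cancel₀ (h0 0)] at this
  field_simp at this
  exact this

/-- Two entire functions with the same finite orders of vanishing differ by a nonvanishing entire
factor. -/
theorem exists_nonvanishing_factor {f P : ℂ → ℂ} (hf : Differentiable ℂ f)
    (hP : Differentiable ℂ P) (hfin : ∀ w, analyticOrderAt P w ≠ ⊤)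
    (hord : ∀ w, analyticOrderAt f w = analyticOrderAt P w) :
    ∃ Q : ℂ → ℂ, Differentiable ℂ Q ∧ (∀ z, Q z ≠ 0) ∧ ∀ z, f z = Q z * P z := by
  have hmf : ∀ w, MeromorphicAt f w := fun w => (hf.analyticAt w).meromorphicAt
  have hmP : ∀ w, MeromorphicAt P w := fun w => (hP.analyticAt w).meromorphicAt
  have hm : MeromorphicOn (f / P) Set.univ := fun w _ => (hmf w).div (hmP w)
  have hzero : ∀ w, meromorphicOrderAt (f / P) w = 0 := fun w => by
    rw [div_eq_mul_inv, meromorphicOrderAt_mul (hmf w) (hmP w).inv, meromorphicOrderAt_inv,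
      (hf.analyticAt w).meromorphicOrderAt_eq, (hP.analyticAt w).meromorphicOrderAt_eq, hord w]
    obtain ⟨n, hn⟩ := ENat.ne_top_iff_exists.1 (hfin w)
    rw [← hn]
    simp only [ENat.map_natCast]
    exact_mod_cast add_neg_cancel (n : ℤ)
  -- The normal form fills in the removable singularities of `f / P`; order zero everywhere then
  -- means analytic and nonvanishing.
  set Q := toMeromorphicNFOn (f / P) Set.univ
  have hNF : ∀ w, MeromorphicNFAt Q w := fun w =>
    meromorphicNFOn_toMeromorphicNFOn (f / P) Set.univ (Set.mem_univ w)
  have hQ0 : ∀ w, meromorphicOrderAt Q w = 0 := fun w => by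
    rw [meromorphicOrderAt_toMeromorphicNFOn hm (Set.mem_univ w), hzero w]
  have hQa : ∀ w, AnalyticAt ℂ Q w := fun w =>
    (hNF w).meromorphicOrderAt_nonneg_iff_analyticAt.1 (hQ0 w).ge
  refine ⟨Q, fun w => (hQa w).differentiableAt, fun w =>
    (hNF w).meromorphicOrderAt_eq_zero_iff.1 (hQ0 w), fun z => ?_⟩
  have hne : ∀ᶠ w in 𝓝[≠] z, P w ≠ 0 := by
    rcases (hP.analyticAt z).eventually_eq_zero_or_eventually_ne_zero with h | h
    · exact absurd (analyticOrderAt_eq_top.2 h) (hfin z)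
    · exact h
  have heq : f =ᶠ[𝓝[≠] z] fun w => Q w * P w := by
    filter_upwards [hne, hm.toMeromorphicNFOn_eq_self_on_nhdsNE (Set.mem_univ z)] with w hw hQw
    rw [show Q w = f w / P w from hQw, div_mul_cancel₀ _ hw]
  exact ((hf.continuous.continuousAt.eventuallyEq_nhds_iff_eventuallyEq_nhdsNE
    ((hQa z).continuousAt.mul hP.continuous.continuousAt)).1 heq).eq_of_nhds

/-! ### The canonical product of genus one -/

theorem norm_E₁_sub_one_le {w : ℂ} (hw : ‖w‖ ≤ 1) : ‖E₁ w - 1‖ ≤ 3 * ‖w‖ ^ 2 := by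
  have h1 := Complex.norm_exp_sub_one_sub_id_le hw
  have h2 : E₁ w - 1 = (1 - w) * (Complex.exp w - 1 - w) - w ^ 2 := by
    rw [E₁]; ring
  have h3 : ‖1 - w‖ ≤ 2 := by
    have := norm_sub_le (1 : ℂ) w
    rw [norm_one] at this
    linarith
  calc ‖E₁ w - 1‖ ≤ ‖1 - w‖ * ‖Complex.exp w - 1 - w‖ + ‖w‖ ^ 2 := by
        rw [h2, ← norm_mul, ← norm_pow]; exact norm_sub_le _ _
    _ ≤ 2 * ‖w‖ ^ 2 + ‖w‖ ^ 2 := by gcongr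
    _ = _ := by ring

theorem norm_E₁_sub_one_le_rpow {w : ℂ} (hw : ‖w‖ ≤ 1) {s : ℝ} (hs0 : 0 < s) (hs : s ≤ 2) :
    ‖E₁ w - 1‖ ≤ 3 * ‖w‖ ^ s := by
  refine (norm_E₁_sub_one_le hw).trans ?_
  gcongr
  rw [← Real.rpow_natCast]
  rcases eq_or_ne w 0 with rfl | h
  · simp [hs0.ne']
  · exact Real.rpow_le_rpow_of_exponent_ge (norm_pos_iff.2 h) hw (by exact_mod_cast hs)

/-- For small `w` the quadratic estimate gives the bound, using `s ≤ 2`. For `|w| ≥ 1` the crude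
bound `exp (2 |w|)` suffices, and this is where `1 ≤ s` enters. -/
theorem norm_E₁_le {s : ℝ} (hs1 : 1 ≤ s) (hs : s ≤ 2) (w : ℂ) :
    ‖E₁ w‖ ≤ Real.exp (3 * ‖w‖ ^ s) := by
  rcases le_total ‖w‖ 1 with hw | hw
  · calc ‖E₁ w‖ = ‖1 + (E₁ w - 1)‖ := by ring_nf
      _ ≤ 1 + 3 * ‖w‖ ^ s := by
        refine (norm_add_le _ _).trans ?_
        rw [norm_one]
        gcongr
        exact norm_E₁_sub_one_le_rpow hw (by linarith) hs
      _ ≤ _ := by linarith [Real.add_one_le_exp (3 * ‖w‖ ^ s)]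
  · have h1 : ‖1 - w‖ ≤ Real.exp ‖w‖ := by
      have := norm_sub_le (1 : ℂ) w
      rw [norm_one] at this
      linarith [Real.add_one_le_exp ‖w‖]
    have h2 : ‖w‖ ≤ ‖w‖ ^ s := Real.self_le_rpow_of_one_le hw hs1
    calc ‖E₁ w‖ ≤ Real.exp ‖w‖ * Real.exp ‖w‖ := by
          rw [E₁, norm_mul]
          gcongr
          exact Complex.norm_exp_le_exp_norm w
      _ ≤ _ := by
        rw [← Real.exp_add]
        gcongr
        linarith [norm_nonneg w]

theorem differentiable_E₁ : Differentiable ℂ E₁ := by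
  unfold E₁; fun_prop

theorem E₁_eq_zero_iff {w : ℂ} : E₁ w = 0 ↔ w = 1 := by
  rw [E₁, mul_eq_zero, or_iff_left (Complex.exp_ne_zero w), sub_eq_zero, eq_comm]

theorem E₁_zero : E₁ 0 = 1 := by simp [E₁]

theorem deriv_E₁_zero : deriv E₁ 0 = 0 := by
  have h := (((hasDerivAt_const (0 : ℂ) (1 : ℂ)).sub (hasDerivAt_id 0)).mul
    (Complex.hasDerivAt_exp 0)).deriv
  refine Eq.trans h ?_
  simp

section Product

variable {ι : Type*} {a : ι → ℂ} {s : ℝ}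

theorem eventually_le_norm (hs0 : 0 < s) (hsum : Summable fun j => 1 / ‖a j‖ ^ s)
    (ha : ∀ j, a j ≠ 0) (R : ℝ) : ∀ᶠ j in cofinite, R < ‖a j‖ := by
  set T := max R 1
  have hT : 0 < T := by positivity
  filter_upwards [hsum.tendsto_cofinite_zero.eventually_lt_const
    (show (0 : ℝ) < 1 / T ^ s by positivity)] with j hj
  have haj : 0 < ‖a j‖ := norm_pos_iff.2 (ha j)
  have h1 : T ^ s < ‖a j‖ ^ s := (one_div_lt_one_div (by positivity) (by positivity)).1 hj
  exact (le_max_left R 1).trans_lt ((Real.rpow_lt_rpow_iff hT.le haj.le hs0).1 h1)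

theorem eventually_norm_E₁_sub_one_le (hs0 : 0 < s) (hs : s ≤ 2)
    (hsum : Summable fun j => 1 / ‖a j‖ ^ s) (ha : ∀ j, a j ≠ 0) (R : ℝ) :
    ∀ᶠ j in cofinite, ∀ z ∈ ball (0 : ℂ) R, ‖E₁ (z / a j) - 1‖ ≤ 3 * R ^ s * (1 / ‖a j‖ ^ s) := by
  filter_upwards [eventually_le_norm hs0 hsum ha R] with j hj z hz
  have hzR : ‖z‖ < R := by simpa using hz
  have haj : 0 < ‖a j‖ := norm_pos_iff.2 (ha j)
  have h1 : ‖z / a j‖ ≤ 1 := by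
    rw [norm_div, div_le_one haj]; linarith
  refine (norm_E₁_sub_one_le_rpow h1 hs0 hs).trans ?_
  rw [norm_div, Real.div_rpow (norm_nonneg _) haj.le, div_eq_mul_one_div, mul_assoc]
  gcongr

theorem summable_norm_E₁_sub_one (hs0 : 0 < s) (hs : s ≤ 2)
    (hsum : Summable fun j => 1 / ‖a j‖ ^ s) (ha : ∀ j, a j ≠ 0) (z : ℂ) :
    Summable fun j => ‖E₁ (z / a j) - 1‖ := by
  refine (hsum.mul_left (3 * (‖z‖ + 1) ^ s)).of_norm_bounded_eventually ?_
  filter_upwards [eventually_norm_E₁_sub_one_le hs0 hs hsum ha (‖z‖ + 1)] with j hj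
  simpa using hj z (by simp)

theorem multipliable_E₁ (hs0 : 0 < s) (hs : s ≤ 2)
    (hsum : Summable fun j => 1 / ‖a j‖ ^ s) (ha : ∀ j, a j ≠ 0) (z : ℂ) :
    Multipliable fun j => E₁ (z / a j) := by
  simpa using multipliable_one_add_of_summable (summable_norm_E₁_sub_one hs0 hs hsum ha z)

theorem hasProdLocallyUniformlyOn_E₁ (hs0 : 0 < s) (hs : s ≤ 2)
    (hsum : Summable fun j => 1 / ‖a j‖ ^ s) (ha : ∀ j, a j ≠ 0) (R : ℝ) :
    HasProdLocallyUniformlyOn (fun j z => E₁ (z / a j)) (fun z => ∏' j, E₁ (z / a j))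
      (ball 0 R) := by
  simpa using Summable.hasProdLocallyUniformlyOn_one_add (f := fun j z => E₁ (z / a j) - 1)
    (isOpen_ball (x := (0 : ℂ)) (ε := R)) (hsum.mul_left (3 * R ^ s))
    (eventually_norm_E₁_sub_one_le hs0 hs hsum ha R) fun j =>
      ((differentiable_E₁.continuous.comp (continuous_id.div_const _)).sub
        continuous_const).continuousOn

theorem differentiable_tprod_E₁ (hs0 : 0 < s) (hs : s ≤ 2)
    (hsum : Summable fun j => 1 / ‖a j‖ ^ s) (ha : ∀ j, a j ≠ 0) :
    Differentiable ℂ fun z => ∏' j, E₁ (z / a j) := fun z => by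
  have h := (hasProdLocallyUniformlyOn_E₁ hs0 hs hsum ha (‖z‖ + 1)).differentiableOn
    (.of_forall fun t => by
      refine DifferentiableOn.fun_finsetProd fun j _ => ?_
      exact (differentiable_E₁.comp (differentiable_id.div_const _)).differentiableOn) isOpen_ball
  exact h.differentiableAt (isOpen_ball.mem_nhds (by simp))

/-- Every partial product has derivative zero at the origin because `E₁' 0 = 0`, and locally uniform
convergence passes to derivatives. -/
theorem hasDerivAt_tprod_E₁_zero (hs0 : 0 < s) (hs : s ≤ 2)
    (hsum : Summable fun j => 1 / ‖a j‖ ^ s) (ha : ∀ j, a j ≠ 0) :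
    HasDerivAt (fun z => ∏' j, E₁ (z / a j)) 0 0 := by
  have hfac : ∀ j, HasDerivAt (fun z => E₁ (z / a j)) 0 0 := fun j => by
    have h0 : HasDerivAt E₁ 0 ((0 : ℂ) / a j) := by
      have := (differentiable_E₁ 0).hasDerivAt
      rw [deriv_E₁_zero] at this
      rwa [zero_div]
    have h1 := h0.comp (0 : ℂ) ((hasDerivAt_id (0 : ℂ)).div_const (a j))
    rw [zero_mul] at h1
    exact h1
  have h := (hasProdLocallyUniformlyOn_iff_tendstoLocallyUniformlyOn.1
    (hasProdLocallyUniformlyOn_E₁ hs0 hs hsum ha 1)).deriv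
    (.of_forall fun t => by
      refine DifferentiableOn.fun_finsetProd fun j _ => ?_
      exact (differentiable_E₁.comp (differentiable_id.div_const _)).differentiableOn) isOpen_ball
  have h1 := h.tendsto_at (show (0 : ℂ) ∈ ball (0 : ℂ) 1 by simp)
  have h2 : ∀ t : Finset ι, deriv (fun z => ∏ j ∈ t, E₁ (z / a j)) 0 = 0 := fun t => by
    classical
    have := (HasDerivAt.fun_finsetProd (u := t) fun j _ => hfac j).deriv
    simpa using this
  have h3 : deriv (fun z => ∏' j, E₁ (z / a j)) 0 = 0 := by
    refine tendsto_nhds_unique h1 ?_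
    simp only [Function.comp_def, h2]
    exact tendsto_const_nhds
  have h4 := (differentiable_tprod_E₁ hs0 hs hsum ha 0).hasDerivAt
  rwa [h3] at h4

theorem norm_tprod_E₁_le (hs1 : 1 ≤ s) (hs : s ≤ 2)
    (hsum : Summable fun j => 1 / ‖a j‖ ^ s) (ha : ∀ j, a j ≠ 0) (z : ℂ) :
    ‖∏' j, E₁ (z / a j)‖ ≤ Real.exp (3 * (∑' j, 1 / ‖a j‖ ^ s) * ‖z‖ ^ s) := by
  have h := (multipliable_E₁ (by linarith) hs hsum ha z).hasProd.norm
  refine le_of_tendsto h (.of_forall fun t => ?_)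
  calc ∏ j ∈ t, ‖E₁ (z / a j)‖ ≤ ∏ j ∈ t, Real.exp (3 * ‖z‖ ^ s * (1 / ‖a j‖ ^ s)) := by
        refine Finset.prod_le_prod (fun _ _ => norm_nonneg _) fun j _ => ?_
        refine (norm_E₁_le hs1 hs _).trans_eq ?_
        rw [norm_div, Real.div_rpow (norm_nonneg _) (norm_nonneg _)]
        congr 1; ring
    _ = Real.exp (3 * ‖z‖ ^ s * ∑ j ∈ t, 1 / ‖a j‖ ^ s) := by
        rw [← Real.exp_sum, Finset.mul_sum]
    _ ≤ Real.exp (3 * ‖z‖ ^ s * ∑' j, 1 / ‖a j‖ ^ s) := by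
        gcongr
        exact hsum.sum_le_tsum t fun _ _ => by positivity
    _ = _ := by ring_nf

theorem tprod_E₁_ne_zero (hs0 : 0 < s) (hs : s ≤ 2)
    (hsum : Summable fun j => 1 / ‖a j‖ ^ s) (ha : ∀ j, a j ≠ 0) {w : ℂ} (hw : ∀ j, a j ≠ w) :
    ∏' j, E₁ (w / a j) ≠ 0 := by
  have := tprod_one_add_ne_zero_of_summable (f := fun j => E₁ (w / a j) - 1) (fun j => by
    simp only [add_sub_cancel, ne_eq, E₁_eq_zero_iff, div_eq_one_iff_eq (ha j)]
    exact (hw j).symm) (summable_norm_E₁_sub_one hs0 hs hsum ha w)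
  simpa using this

/-- The order of vanishing of the canonical product at `w` is the number of indices `j` with
`a j = w`. -/
theorem analyticOrderAt_tprod_E₁ (hs0 : 0 < s) (hs : s ≤ 2)
    (hsum : Summable fun j => 1 / ‖a j‖ ^ s) (ha : ∀ j, a j ≠ 0) (w : ℂ) :
    analyticOrderAt (fun z => ∏' j, E₁ (z / a j)) w = (Nat.card {j // a j = w} : ℕ∞) := by
  have hfin : {j | a j = w}.Finite := by
    refine (eventually_cofinite.1 (eventually_le_norm hs0 hsum ha ‖w‖)).subset ?_
    rintro j rfl
    simp
  set T := hfin.toFinset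
  have hcard : Nat.card {j // a j = w} = T.card := by
    rw [← Set.ncard_eq_toFinset_card _ hfin]; rfl
  rw [hcard, ((differentiable_tprod_E₁ hs0 hs hsum ha).analyticAt w).analyticOrderAt_eq_natCast]
  have hsum' : Summable fun j : ((T : Set ι)ᶜ : Set ι) => 1 / ‖a j‖ ^ s :=
    hsum.subtype _
  have ha' : ∀ j : ((T : Set ι)ᶜ : Set ι), a j ≠ 0 := fun j => ha j
  set r : ℂ → ℂ := fun z => ∏' j : ((T : Set ι)ᶜ : Set ι), E₁ (z / a j)
  have hr : Differentiable ℂ r := differentiable_tprod_E₁ hs0 hs hsum' ha'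
  have hrw : r w ≠ 0 := tprod_E₁_ne_zero hs0 hs hsum' ha' fun j hj => j.2 (by simpa [T] using hj)
  -- For `a j = w`, `1 - z / a j = -(a j)⁻¹ (z - w)`: the finite fibre supplies the power of `z -
  -- w`, and the complementary product `r` does not vanish at `w`.
  refine ⟨fun z => (∏ j ∈ T, (-(a j)⁻¹ * Complex.exp (z / a j))) * r z, ?_, ?_,
    .of_forall fun z => ?_⟩
  · have : Differentiable ℂ fun z => (∏ j ∈ T, (-(a j)⁻¹ * Complex.exp (z / a j))) * r z := by
      fun_prop
    exact this.analyticAt w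
  · refine mul_ne_zero (Finset.prod_ne_zero_iff.2 fun j _ => ?_) hrw
    simp [ha j]
  · have hsplit := Multipliable.tprod_mul_tprod_compl (f := fun j => E₁ (z / a j))
      (s := (T : Set ι)) (Multipliable.of_finite)
      (multipliable_E₁ hs0 hs hsum' ha' z)
    rw [← hsplit, Finset.tprod_subtype' T (fun j => E₁ (z / a j)), smul_eq_mul, ← mul_assoc]
    congr 1
    rw [← Finset.prod_const, ← Finset.prod_mul_distrib]
    refine Finset.prod_congr rfl fun j hj => ?_
    have hjw : a j = w := by simpa [T] using hj
    rw [E₁, ← hjw]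
    have := ha j
    field_simp
    ring

end Product

end McKeanVlasov

namespace McKeanVlasov

open Complex Filter Topology Metric

/-! ### Gaussian domination of the invariant density -/

/-- `U - m x² / 2` is convex and even, so midpoint convexity at `±x` puts its minimum at the origin.
-/
theorem add_mul_sq_le_of_even {U : ℝ → ℝ} {m : ℝ} (hU : ContDiff ℝ 2 U)
    (heven : ∀ x, U (-x) = U x) (hm : ∀ x, m ≤ iteratedDeriv 2 U x) (x : ℝ) :
    U 0 + m / 2 * x ^ 2 ≤ U x := by
  have hU1 : Differentiable ℝ U := hU.differentiable (by norm_num)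
  have hU2 : Differentiable ℝ (deriv U) := hU.differentiable_deriv_two
  set h : ℝ → ℝ := fun x => U x - m / 2 * x ^ 2
  have hd1 : ∀ x, HasDerivAt h (deriv U x - m * x) x := fun x => by
    have := (hU1 x).hasDerivAt.sub (((hasDerivAt_id x).pow 2).const_mul (m / 2))
    convert! this using 1
    simp; ring
  have hd1' : deriv h = fun x => deriv U x - m * x := funext fun x => (hd1 x).deriv
  have hd2 : ∀ x, HasDerivAt (deriv h) (deriv (deriv U) x - m) x := fun x => by
    rw [hd1']
    have := (hU2 x).hasDerivAt.sub ((hasDerivAt_id x).const_mul m)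
    rw [mul_one] at this
    exact this
  have hconv : ConvexOn ℝ Set.univ h := by
    refine convexOn_univ_of_deriv2_nonneg (fun x => (hd1 x).differentiableAt)
      (fun x => (hd2 x).differentiableAt) fun x => ?_
    have := hm x
    rw [iteratedDeriv_succ, iteratedDeriv_one] at this
    rw [Function.iterate_succ, Function.iterate_one, Function.comp_apply, (hd2 x).deriv]
    linarith
  have := hconv.2 (Set.mem_univ x) (Set.mem_univ (-x)) (show (0 : ℝ) ≤ 1 / 2 by norm_num)
    (show (0 : ℝ) ≤ 1 / 2 by norm_num) (by norm_num)
  simp only [h, smul_eq_mul, heven] at this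
  ring_nf at this
  linarith

/-- `U'' ≥ C_V - α` yields `2V ≥ 2 U 0 + C_V x²`, and `W ⋆ π ≥ 0` can only lower the weight. -/
theorem IsInvariantDensity.exists_gaussian_bound {V W U π : ℝ → ℝ} {α C_V C_W : ℝ}
    (hVW : PotentialAssumption V W U α C_V C_W) (hπ : IsInvariantDensity V W π) :
    ∃ K, ∀ x, π x ≤ K * Real.exp (-C_V * x ^ 2) := by
  have hm : ∀ x, C_V - α ≤ iteratedDeriv 2 U x := fun x => hVW.C_V_spec.1 ⟨x, rfl⟩
  have hU : ContDiff ℝ 2 U ∧ ∀ x, U (-x) = U x := by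
    rcases hVW.perturbation with h | h
    · rw [show U = fun _ => 0 from funext h]
      exact ⟨contDiff_const, fun _ => rfl⟩
    · obtain ⟨J, hJ, hc, -⟩ := h.smoothness
      exact ⟨hc.of_le (WithTop.coe_le_coe.2 (by exact_mod_cast hJ : (2 : ℕ∞) ≤ J)), h.even⟩
  have hZ : 0 ≤ ∫ y, weight V W π y :=
    MeasureTheory.integral_nonneg fun y => (Real.exp_pos _).le
  refine ⟨1 / (∫ y, weight V W π y) * Real.exp (-2 * U 0), fun x => ?_⟩
  rw [hπ.eq_gibbs x, mul_assoc, ← Real.exp_add, weight]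
  gcongr
  have h1 := add_mul_sq_le_of_even hU.1 hU.2 hm x
  have h2 : 0 ≤ conv W π x :=
    MeasureTheory.integral_nonneg fun y => mul_nonneg (hVW.W_nonneg _) (hπ.nonneg y)
  have h3 := hVW.V_eq x
  nlinarith

theorem exp_mul_exp_neg_mul_sq_le {c : ℝ} (hc : 0 < c) (t x : ℝ) :
    Real.exp (t * x) * Real.exp (-c * x ^ 2) ≤
      Real.exp (t ^ 2 / (2 * c)) * Real.exp (-(c / 2) * x ^ 2) := by
  rw [← Real.exp_add, ← Real.exp_add, Real.exp_le_exp]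
  have h : t ^ 2 / (2 * c) + -(c / 2) * x ^ 2 - (t * x + -c * x ^ 2) =
      (t - c * x) ^ 2 / (2 * c) := by field_simp; ring
  have : 0 ≤ (t - c * x) ^ 2 / (2 * c) := by positivity
  linarith

/-! ### The Fourier transform as an entire function -/

section Fourier

variable {π : ℝ → ℝ} {K c : ℝ}

theorem exp_mul_density_le (hc : 0 < c) (hK : ∀ x, π x ≤ K * Real.exp (-c * x ^ 2)) (t x : ℝ) :
    Real.exp (t * x) * π x ≤
      |K| * Real.exp (t ^ 2 / (2 * c)) * Real.exp (-(c / 2) * x ^ 2) := by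
  calc Real.exp (t * x) * π x ≤ Real.exp (t * x) * (|K| * Real.exp (-c * x ^ 2)) := by
        gcongr
        exact (hK x).trans (by gcongr; exact le_abs_self K)
    _ = |K| * (Real.exp (t * x) * Real.exp (-c * x ^ 2)) := by ring
    _ ≤ |K| * (Real.exp (t ^ 2 / (2 * c)) * Real.exp (-(c / 2) * x ^ 2)) := by
        gcongr ?_ * ?_
        exact exp_mul_exp_neg_mul_sq_le hc t x
    _ = _ := by ring

theorem integrable_exp_mul_density (hπ0 : ∀ x, 0 ≤ π x) (hπi : MeasureTheory.Integrable π)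
    (hc : 0 < c) (hK : ∀ x, π x ≤ K * Real.exp (-c * x ^ 2)) (t : ℝ) :
    MeasureTheory.Integrable fun x => Real.exp (t * x) * π x := by
  refine ((integrable_exp_neg_mul_sq (half_pos hc)).const_mul
    (|K| * Real.exp (t ^ 2 / (2 * c)))).mono' ?_ (.of_forall fun x => ?_)
  · exact (Continuous.aestronglyMeasurable (by fun_prop)).mul hπi.aestronglyMeasurable
  · rw [Real.norm_of_nonneg (mul_nonneg (Real.exp_pos _).le (hπ0 x))]
    exact exp_mul_density_le hc hK t x

theorem norm_cfourier_integrand (hπ0 : ∀ x, 0 ≤ π x) (z : ℂ) (x : ℝ) :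
    ‖Complex.exp (I * z * (x : ℂ)) * (π x : ℂ)‖ = Real.exp (-z.im * x) * π x := by
  rw [norm_mul, Complex.norm_exp, Complex.norm_real, Real.norm_of_nonneg (hπ0 x)]
  simp

theorem norm_cfourier_le (hπ0 : ∀ x, 0 ≤ π x) (hπi : MeasureTheory.Integrable π)
    (hc : 0 < c) (hK : ∀ x, π x ≤ K * Real.exp (-c * x ^ 2)) (z : ℂ) :
    ‖cfourier π z‖ ≤ |K| * Real.exp (‖z‖ ^ 2 / (2 * c)) * √(Real.pi / (c / 2)) := by
  calc ‖cfourier π z‖ ≤ ∫ x, Real.exp (-z.im * x) * π x := by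
        refine (MeasureTheory.norm_integral_le_integral_norm _).trans_eq ?_
        simp only [norm_cfourier_integrand hπ0]
    _ ≤ ∫ x, |K| * Real.exp ((-z.im) ^ 2 / (2 * c)) * Real.exp (-(c / 2) * x ^ 2) :=
        MeasureTheory.integral_mono (integrable_exp_mul_density hπ0 hπi hc hK _)
          ((integrable_exp_neg_mul_sq (half_pos hc)).const_mul _)
          fun x => exp_mul_density_le hc hK _ x
    _ = |K| * Real.exp ((-z.im) ^ 2 / (2 * c)) * √(Real.pi / (c / 2)) := by
        rw [MeasureTheory.integral_const_mul, integral_gaussian]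
    _ ≤ _ := by
        have h : (-z.im) ^ 2 ≤ ‖z‖ ^ 2 := by
          rw [neg_sq, ← sq_abs]
          gcongr
          exact Complex.abs_im_le_norm z
        gcongr

theorem exists_norm_cfourier_le_exp (hπ0 : ∀ x, 0 ≤ π x) (hπi : MeasureTheory.Integrable π)
    (hc : 0 < c) (hK : ∀ x, π x ≤ K * Real.exp (-c * x ^ 2)) :
    ∃ C, 0 ≤ C ∧ ∀ z, ‖cfourier π z‖ ≤ Real.exp (C * (1 + ‖z‖ ^ (2 : ℝ))) := by
  set A := |K| * √(Real.pi / (c / 2))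
  have hA : 0 ≤ A := by positivity
  have hc' : 0 ≤ 1 / (2 * c) := by positivity
  refine ⟨A + 1 / (2 * c), by positivity, fun z => ?_⟩
  calc ‖cfourier π z‖ ≤ A * Real.exp (‖z‖ ^ 2 / (2 * c)) :=
        (norm_cfourier_le hπ0 hπi hc hK z).trans_eq (by ring)
    _ ≤ Real.exp A * Real.exp (‖z‖ ^ 2 / (2 * c)) := by
        gcongr
        linarith [Real.add_one_le_exp A]
    _ ≤ _ := by
        rw [← Real.exp_add, Real.rpow_two]
        gcongr
        have : 0 ≤ A * ‖z‖ ^ 2 := by positivity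
        rw [div_eq_mul_one_div]
        nlinarith

/-- `cfourier π z` is the complex moment generating function of `π dx` at `I * z`; all exponential
moments are finite, so that function is entire. -/
theorem differentiable_cfourier (hπ0 : ∀ x, 0 ≤ π x) (hπi : MeasureTheory.Integrable π)
    (hc : 0 < c) (hK : ∀ x, π x ≤ K * Real.exp (-c * x ^ 2)) :
    Differentiable ℂ (cfourier π) := by
  set μ := (MeasureTheory.volume : MeasureTheory.Measure ℝ).withDensity
    fun x => ENNReal.ofReal (π x)
  have hmeas : AEMeasurable (fun x => ENNReal.ofReal (π x)) := hπi.aemeasurable.ennreal_ofReal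
  have hlt : ∀ᵐ x, ENNReal.ofReal (π x) < ⊤ := .of_forall fun x => ENNReal.ofReal_lt_top
  have huniv : ProbabilityTheory.integrableExpSet id μ = Set.univ := by
    refine Set.eq_univ_of_forall fun t => ?_
    rw [ProbabilityTheory.integrableExpSet, Set.mem_ofPred_eq,
      MeasureTheory.integrable_withDensity_iff_integrable_smul₀' hmeas hlt]
    refine (integrable_exp_mul_density hπ0 hπi hc hK t).congr (.of_forall fun x => ?_)
    simp [ENNReal.toReal_ofReal (hπ0 x), mul_comm]
  have heq : cfourier π = fun z => ProbabilityTheory.complexMGF id μ (I * z) := by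
    ext z
    rw [ProbabilityTheory.complexMGF, integral_withDensity_eq_integral_toReal_smul₀ hmeas hlt,
      cfourier]
    congr 1
    ext x
    simp [ENNReal.toReal_ofReal (hπ0 x), mul_comm]
  have hd : Differentiable ℂ (ProbabilityTheory.complexMGF id μ) := fun z =>
    (ProbabilityTheory.hasDerivAt_complexMGF (by simp [huniv])).differentiableAt
  rw [heq]
  exact hd.comp (differentiable_id.const_mul I)

theorem cfourier_zero (hπ1 : ∫ x, π x = 1) : cfourier π 0 = 1 := by
  simp [cfourier, integral_complex_ofReal, hπ1]

theorem conj_cfourier_neg_conj (z : ℂ) :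
    (starRingEnd ℂ) (cfourier π (-(starRingEnd ℂ) z)) = cfourier π z := by
  rw [cfourier, cfourier, ← integral_conj]
  congr 1
  ext x
  simp [← Complex.exp_conj]

theorem two_le_norm_cfourier_add (hπ0 : ∀ x, 0 ≤ π x) (hπi : MeasureTheory.Integrable π)
    (hπ1 : ∫ x, π x = 1)
    (hc : 0 < c) (hK : ∀ x, π x ≤ K * Real.exp (-c * x ^ 2)) (y : ℝ) :
    2 ≤ ‖cfourier π (I * y)‖ + ‖cfourier π (-(I * y))‖ := by
  have hi := integrable_exp_mul_density hπ0 hπi hc hK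
  have heq : ∀ t : ℝ, cfourier π (I * t) = ((∫ x, Real.exp (-t * x) * π x : ℝ) : ℂ) := fun t => by
    rw [cfourier, ← integral_complex_ofReal]
    congr 1
    ext x
    push_cast
    congr 2
    linear_combination (t * x : ℂ) * I_mul_I
  have hnorm : ∀ t : ℝ, ∫ x, Real.exp (-t * x) * π x ≤ ‖cfourier π (I * t)‖ := fun t => by
    rw [heq, Complex.norm_real]
    exact le_abs_self _
  have h1 := hnorm y
  have h2 := hnorm (-y)
  rw [ofReal_neg, mul_neg] at h2
  refine le_trans ?_ (add_le_add h1 h2)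
  rw [← MeasureTheory.integral_add (hi _) (hi _)]
  calc (2 : ℝ) = ∫ x, 2 * π x := by rw [MeasureTheory.integral_const_mul, hπ1, mul_one]
    _ ≤ _ := by
      refine MeasureTheory.integral_mono (hπi.const_mul 2) ((hi _).add (hi _)) fun x => ?_
      simp only
      rw [← add_mul]
      refine mul_le_mul_of_nonneg_right ?_ (hπ0 x)
      -- The linear terms of the two tangent-line bounds cancel, leaving `2`.
      have h3 := Real.add_one_le_exp (-y * x)
      have h4 := Real.add_one_le_exp (- -y * x)
      linarith

end Fourier

/-! ### Order, exponent of convergence and Hadamard factorization -/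

theorem order_le_two {f : ℂ → ℂ} {C : ℝ} (hC : 0 ≤ C)
    (hf : ∀ z, ‖f z‖ ≤ Real.exp (C * (1 + ‖z‖ ^ (2 : ℝ)))) : order f ≤ 2 := by
  refine ENNReal.le_of_forall_pos_le_add fun ε hε _ => ?_
  -- The definition of `order` allows no constant in the exponent; the extra `|z|^ε` eventually
  -- exceeds `2C` and absorbs it.
  refine (iInf₂_le (2 + ε) ?_).trans_eq (by simp)
  refine Asymptotics.IsBigO.of_bound 1 ?_
  have hlim : Tendsto (fun z : ℂ => ‖z‖ ^ (ε : ℝ)) (Bornology.cobounded ℂ) atTop :=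
    (tendsto_rpow_atTop (by exact_mod_cast hε)).comp tendsto_norm_cobounded_atTop
  filter_upwards [hlim.eventually_ge_atTop (2 * C),
    tendsto_norm_cobounded_atTop.eventually_ge_atTop 1] with z hz hz1
  rw [one_mul, Real.norm_of_nonneg (Real.exp_pos _).le]
  refine (hf z).trans (Real.exp_le_exp.2 ?_)
  have h1 : 1 ≤ ‖z‖ ^ (2 : ℝ) := Real.one_le_rpow hz1 (by norm_num)
  push_cast
  rw [Real.rpow_add (by linarith)]
  nlinarith [mul_le_mul_of_nonneg_left hz (zero_le_one.trans h1),
    mul_nonneg hC (sub_nonneg.2 h1)]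

theorem exists_summable_of_zeroExponent_lt_two {f : ℂ → ℂ} (h0 : f 0 ≠ 0)
    (h : zeroExponent f < 2) :
    ∃ s : ℝ, 1 ≤ s ∧ s < 2 ∧ Summable fun j : ZeroIndex f => 1 / ‖zero f j‖ ^ s := by
  simp only [zeroExponent, iInf_lt_iff] at h
  obtain ⟨r, ⟨hr0, hr⟩, hr2⟩ := h
  have hr2' : (r : ℝ) < 2 := by exact_mod_cast hr2
  have ha : ∀ j : ZeroIndex f, zero f j ≠ 0 := fun j hj => h0 (by
    have : f (zero f j) = 0 := j.1.2
    rwa [hj] at this)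
  -- `norm_E₁_le` needs an exponent of at least one. Raising `r` keeps summability because all but
  -- finitely many zeros have modulus above one.
  refine ⟨max r 1, le_max_right _ _, max_lt hr2' (by norm_num), ?_⟩
  refine hr.of_norm_bounded_eventually ?_
  filter_upwards [eventually_le_norm (by exact_mod_cast hr0) hr ha 1] with j hj
  rw [Real.norm_of_nonneg (by positivity)]
  gcongr
  exacts [hj.le, le_max_left _ _]

theorem card_zeroIndex_fiber {f : ℂ → ℂ} (hf : Differentiable ℂ f) (w : ℂ) :
    Nat.card {j : ZeroIndex f // zero f j = w} = analyticOrderNatAt f w := by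
  by_cases hw : f w = 0
  · rw [← Nat.card_fin (analyticOrderNatAt f w)]
    refine (Nat.card_congr (Equiv.ofBijective
      (fun i : Fin (analyticOrderNatAt f w) =>
        (⟨⟨⟨w, hw⟩, i⟩, rfl⟩ : {j : ZeroIndex f // zero f j = w})) ⟨fun i j hij => ?_, ?_⟩)).symm
    · exact eq_of_heq (Sigma.mk.inj (Subtype.ext_iff.1 hij)).2
    · rintro ⟨⟨⟨w', h⟩, i⟩, rfl⟩
      exact ⟨i, rfl⟩
  · have : IsEmpty {j : ZeroIndex f // zero f j = w} := ⟨fun j => hw (j.2 ▸ j.1.1.2)⟩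
    rw [Nat.card_of_isEmpty, analyticOrderNatAt, (hf.analyticAt w).analyticOrderAt_eq_zero.2 hw]
    rfl

/-- Hadamard factorization in genus one for an entire function of growth at most
`exp (C (1 + |z|²))` whose zeros have exponent of convergence less than two. -/
theorem exists_eq_exp_mul_tprod {f : ℂ → ℂ} (hf : Differentiable ℂ f) (h0 : f 0 = 1) {C s : ℝ}
    (hC : 0 ≤ C) (hfC : ∀ z, ‖f z‖ ≤ Real.exp (C * (1 + ‖z‖ ^ (2 : ℝ)))) (hs1 : 1 ≤ s) (hs2 : s < 2)
    (hsum : Summable fun j : ZeroIndex f => 1 / ‖zero f j‖ ^ s) :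
    ∃ a b : ℂ, ∀ z, f z = Complex.exp (a * z + b * z ^ 2) * ∏' j, E₁ (z / zero f j) := by
  have ha : ∀ j : ZeroIndex f, zero f j ≠ 0 := fun j hj => by
    have : f (zero f j) = 0 := j.1.2
    rw [hj, h0] at this
    exact one_ne_zero this
  have hs0 : 0 < s := by linarith
  set P : ℂ → ℂ := fun z => ∏' j, E₁ (z / zero f j)
  have hP : Differentiable ℂ P := differentiable_tprod_E₁ hs0 hs2.le hsum ha
  have hP0 : P 0 = 1 := by simp [P, E₁_zero]
  have hordP : ∀ w, analyticOrderAt P w = (analyticOrderNatAt f w : ℕ∞) := fun w => by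
    rw [← card_zeroIndex_fiber hf w]
    exact analyticOrderAt_tprod_E₁ hs0 hs2.le hsum ha w
  have hfinf : ∀ w, analyticOrderAt f w ≠ ⊤ := fun w hw => by
    have hev := analyticOrderAt_eq_top.1 hw
    have hz := AnalyticOnNhd.eqOn_zero_of_preconnected_of_eventuallyEq_zero (U := Set.univ)
      (fun z _ => hf.analyticAt z) isPreconnected_univ (Set.mem_univ w) hev (Set.mem_univ 0)
    rw [h0] at hz
    exact one_ne_zero hz
  obtain ⟨Q, hQ, hQ0, hfQ⟩ := exists_nonvanishing_factor hf hP
    (fun w => by rw [hordP]; exact ENat.natCast_ne_top _)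
    (fun w => by rw [hordP, Nat.cast_analyticOrderNatAt (hfinf w)])
  obtain ⟨q, hq, hQq⟩ := exists_differentiable_exp_eq hQ hQ0
  set S := ∑' j : ZeroIndex f, 1 / ‖zero f j‖ ^ s
  have hS : 0 ≤ S := tsum_nonneg fun j => by positivity
  -- `C + 3 * S` serves both `f` and `P`, since the coefficient lemma takes one common constant.
  have hPC : ∀ z, ‖P z‖ ≤ Real.exp ((C + 3 * S) * (1 + ‖z‖ ^ (2 : ℝ))) := fun z => by
    refine (norm_tprod_E₁_le hs1 hs2.le hsum ha z).trans (Real.exp_le_exp.2 ?_)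
    have h1 : ‖z‖ ^ s ≤ 1 + ‖z‖ ^ (2 : ℝ) := by
      rcases le_total ‖z‖ 1 with h | h
      · have := Real.rpow_le_one (norm_nonneg z) h hs0.le
        have : 0 ≤ ‖z‖ ^ (2 : ℝ) := by positivity
        linarith
      · have := Real.rpow_le_rpow_of_exponent_le h hs2.le
        linarith
    gcongr
    linarith
  have hcoef : ∀ n, 3 ≤ n → iteratedDeriv n q 0 = 0 := fun n hn =>
    iteratedDeriv_eq_zero_of_growth hf hP hq (by simp [h0])
      (fun z => by rw [hfQ, hQq]) (C := C + 3 * S) (by positivity)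
      (fun z => (hfC z).trans (by gcongr; linarith)) hPC (by omega)
      (by exact_mod_cast (show 2 < n by omega))
  refine ⟨iteratedDeriv 1 q 0, iteratedDeriv 2 q 0 / 2, fun z => ?_⟩
  have hq0 : Complex.exp (q 0) = 1 := by
    have := hfQ 0
    rw [h0, hP0, mul_one, hQq] at this
    exact this.symm
  rw [hfQ, hQq, eq_quadratic_of_iteratedDeriv_eq_zero hq hcoef z, add_assoc, Complex.exp_add, hq0,
    one_mul]

/-! ### Reality and sign of the Gaussian factor -/

theorem iteratedDeriv_two_quadratic (A B : ℂ) :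
    iteratedDeriv 2 (fun z : ℂ => A * z + B * z ^ 2) 0 = 2 * B := by
  have h1 : deriv (fun z : ℂ => A * z + B * z ^ 2) = fun z => A + 2 * B * z := by
    ext z
    have := (((hasDerivAt_id z).const_mul A).add (((hasDerivAt_id z).pow 2).const_mul B)).deriv
    refine Eq.trans this ?_
    simp
    ring
  have h2 := (((hasDerivAt_id (0 : ℂ)).const_mul (2 * B)).const_add A).deriv
  rw [iteratedDeriv_succ, iteratedDeriv_one, h1]
  refine Eq.trans h2 (mul_one _)

theorem differentiable_conj_neg_conj {f : ℂ → ℂ} (hf : Differentiable ℂ f) :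
    Differentiable ℂ fun z => (starRingEnd ℂ) (f (-(starRingEnd ℂ) z)) := fun z => by
  have h : DifferentiableAt ℂ (fun w => f (-w)) ((starRingEnd ℂ) z) :=
    (hf.comp differentiable_neg) _
  simpa [Function.comp_def] using h.conj_conj

/-- If an entire function invariant under `z ↦ conj (f (-conj z))` is a product of a Gaussian factor
and an entire function `P` of order less than two with `P' 0 = 0`, then the Gaussian factor has a
purely imaginary linear coefficient and a real quadratic coefficient. -/
theorem re_eq_zero_and_im_eq_zero_of_symmetric {f P : ℂ → ℂ} {a b : ℂ}
    (hsymm : ∀ z, (starRingEnd ℂ) (f (-(starRingEnd ℂ) z)) = f z)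
    (hP : Differentiable ℂ P) (hP0 : P 0 = 1) (hP' : HasDerivAt P 0 0)
    (hfP : ∀ z, f z = Complex.exp (a * z + b * z ^ 2) * P z) {C s : ℝ} (hC : 0 ≤ C) (hs : s < 2)
    (hPs : ∀ z, ‖P z‖ ≤ Real.exp (C * (1 + ‖z‖ ^ s))) : a.re = 0 ∧ b.im = 0 := by
  set a' := (starRingEnd ℂ) a
  set b' := (starRingEnd ℂ) b
  constructor
  -- As `P 0 = 1` and `P' 0 = 0`, the derivative of `f` at the origin is `a`; the symmetry turns it
  -- into `-conj a`.
  · have hf : HasDerivAt f a 0 := by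
      have hq : HasDerivAt (fun z : ℂ => a * z + b * z ^ 2) a 0 := by
        have := ((hasDerivAt_id (0 : ℂ)).const_mul a).add
          (((hasDerivAt_id (0 : ℂ)).pow 2).const_mul b)
        simpa using! this
      have := hq.cexp.mul hP'
      simp only [hP0] at this
      rw [show f = fun z => Complex.exp (a * z + b * z ^ 2) * P z from funext hfP]
      simpa using! this
    have hf' : HasDerivAt f (-a') 0 := by
      have h1 : HasDerivAt (fun w => f (-w)) (-a) ((starRingEnd ℂ) 0) := by
        have h2 : HasDerivAt f a (-(starRingEnd ℂ) 0) := by simpa using hf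
        have := h2.comp ((starRingEnd ℂ) (0 : ℂ)) (hasDerivAt_neg _)
        simpa using! this
      have h3 := h1.conj_conj
      rw [show f = fun z => (starRingEnd ℂ) (f (-(starRingEnd ℂ) z)) from
        funext fun z => (hsymm z).symm]
      simpa [Function.comp_def] using h3
    have := congrArg Complex.re (hf.unique hf')
    simp only [neg_re, a', conj_re] at this
    linarith
  -- The reflected product and `P` differ by an exponential whose quadratic coefficient is `b - conj
  -- b`. Both have growth exponent `s < 2`, so that coefficient vanishes.
  · have hPP : ∀ z, (starRingEnd ℂ) (P (-(starRingEnd ℂ) z)) =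
        Complex.exp ((a + a') * z + (b - b') * z ^ 2) * P z := fun z => by
      have h1 := hsymm z
      rw [hfP, hfP, map_mul, ← Complex.exp_conj] at h1
      have h2 : (starRingEnd ℂ) (a * -(starRingEnd ℂ) z + b * (-(starRingEnd ℂ) z) ^ 2) =
          -a' * z + b' * z ^ 2 := by simp [a', b']
      rw [h2] at h1
      rw [show (a + a') * z + (b - b') * z ^ 2 =
        (a * z + b * z ^ 2) - (-a' * z + b' * z ^ 2) by ring, Complex.exp_sub, div_mul_eq_mul_div,
        eq_div_iff (Complex.exp_ne_zero _), mul_comm]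
      exact h1
    have h := iteratedDeriv_eq_zero_of_growth (differentiable_conj_neg_conj hP) hP
      (q := fun z => (a + a') * z + (b - b') * z ^ 2) (by fun_prop) (by simp [hP0]) hPP hC
      (fun z => by simpa using hPs (-(starRingEnd ℂ) z)) hPs (n := 2) two_ne_zero
      (by exact_mod_cast hs)
    rw [iteratedDeriv_two_quadratic] at h
    have := congrArg Complex.im h
    simp [b'] at this
    linarith

/-- If `f (i y)` and `f (-i y)` are not both small for large `y`, then the Gaussian factor of `f`
does not grow along the real axis. -/
theorem quadratic_coeff_nonpos {f P : ℂ → ℂ} {p b : ℝ}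
    (hf : ∀ y : ℝ, 2 ≤ ‖f (I * y)‖ + ‖f (-(I * y))‖)
    (hfP : ∀ z, f z = Complex.exp (I * p * z + b * z ^ 2) * P z) {C s : ℝ} (hs : s < 2)
    (hPs : ∀ z, ‖P z‖ ≤ Real.exp (C * ‖z‖ ^ s)) : b ≤ 0 := by
  have hbd : ∀ y : ℝ, ‖f (I * y)‖ ≤ Real.exp (|p| * |y| - b * y ^ 2 + C * |y| ^ s) := fun y => by
    rw [hfP, norm_mul, Complex.norm_exp, Real.exp_add]
    have hre : (I * p * (I * y) + b * (I * y) ^ 2 : ℂ).re = -(p * y) - b * y ^ 2 := by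
      rw [show (I * p * (I * y) + b * (I * y) ^ 2 : ℂ) = ((-(p * y) - b * y ^ 2 : ℝ) : ℂ) by
        push_cast; linear_combination (p * y + b * y ^ 2 : ℂ) * I_sq, ofReal_re]
    rw [hre]
    gcongr
    · rw [← abs_mul]; exact neg_le_abs _
    · simpa using hPs (I * y)
  have key : ∀ y : ℝ, 0 < y → b ≤ |p| * y ^ (-(1 : ℝ)) + C * y ^ (-(2 - s)) := fun y hy => by
    have h1 := hbd y
    have h2 := hbd (-y)
    rw [ofReal_neg, mul_neg, abs_neg, neg_sq] at h2
    have h3 := hf y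
    rw [abs_of_pos hy] at h1 h2
    -- Both values obey the same upper bound and sum to at least two, so this bound is at least one;
    -- dividing its exponent by `y²` and letting `y → ∞` isolates `b`.
    have h4 : Real.exp 0 ≤ Real.exp (|p| * y - b * y ^ 2 + C * y ^ s) := by
      rw [Real.exp_zero]; linarith
    rw [Real.exp_le_exp] at h4
    have hy2 : 0 < y ^ 2 := by positivity
    have h5 : b ≤ (|p| * y + C * y ^ s) / y ^ 2 := by
      rw [le_div_iff₀ hy2]; linarith
    refine h5.trans_eq ?_
    rw [neg_sub, Real.rpow_sub hy, Real.rpow_two, Real.rpow_neg_one]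
    field_simp
  have hlim : Tendsto (fun y : ℝ => |p| * y ^ (-(1 : ℝ)) + C * y ^ (-(2 - s))) atTop
      (𝓝 (|p| * 0 + C * 0)) :=
    ((tendsto_rpow_neg_atTop one_pos).const_mul _).add
      ((tendsto_rpow_neg_atTop (sub_pos.2 hs)).const_mul _)
  have := ge_of_tendsto hlim (eventually_atTop.2 ⟨1, fun y hy => key y (by linarith)⟩)
  simpa using this

theorem zeroExponent_lt_two_of_growthAssumption {f : ℂ → ℂ} (hord : order f ≤ 2)
    (h : GrowthAssumption f) : zeroExponent f < 2 := by
  rcases h with h | ⟨h1, h2⟩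
  · exact h.trans_le hord
  · exact h1 ▸ h2

end McKeanVlasov

/-! ### Assembly of the factorization -/

theorem theorem5p2 (V W U : ℝ → ℝ) (α C_V C_W : ℝ) (π : ℝ → ℝ)
    (hVW : McKeanVlasov.PotentialAssumption V W U α C_V C_W)
    (hπ : McKeanVlasov.IsInvariantDensity V W π)
    (hgrowth : McKeanVlasov.GrowthAssumption (McKeanVlasov.cfourier π)) :
    ∃ p₁ p₂ : ℝ, 0 ≤ p₂ ∧ ∀ z : ℂ,
      Multipliable (fun j : McKeanVlasov.ZeroIndex (McKeanVlasov.cfourier π) =>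
        McKeanVlasov.E₁ (z / McKeanVlasov.zero (McKeanVlasov.cfourier π) j)) ∧
      McKeanVlasov.cfourier π z =
        Complex.exp (-(p₂ : ℂ) * z ^ 2 + Complex.I * (p₁ : ℂ) * z) *
          ∏' j : McKeanVlasov.ZeroIndex (McKeanVlasov.cfourier π),
            McKeanVlasov.E₁ (z / McKeanVlasov.zero (McKeanVlasov.cfourier π) j) := by
  open McKeanVlasov in
  obtain ⟨K, hK⟩ := hπ.exists_gaussian_bound hVW
  have hc := hVW.C_V_pos
  have hf := differentiable_cfourier hπ.nonneg hπ.integrable hc hK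
  have hf0 : cfourier π 0 = 1 := cfourier_zero hπ.integral_eq_one
  obtain ⟨C, hC, hfC⟩ := exists_norm_cfourier_le_exp hπ.nonneg hπ.integrable hc hK
  obtain ⟨s, hs1, hs2, hsum⟩ := exists_summable_of_zeroExponent_lt_two (by simp [hf0])
    (zeroExponent_lt_two_of_growthAssumption (order_le_two hC hfC) hgrowth)
  obtain ⟨a, b, hab⟩ := exists_eq_exp_mul_tprod hf hf0 hC hfC hs1 hs2 hsum
  have ha : ∀ j : ZeroIndex (cfourier π), zero (cfourier π) j ≠ 0 := fun j hj => by
    have : cfourier π (zero (cfourier π) j) = 0 := j.1.2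
    rw [hj, hf0] at this
    exact one_ne_zero this
  have hs0 : 0 < s := by linarith
  have hPs := norm_tprod_E₁_le hs1 hs2.le hsum ha
  obtain ⟨hare, hbim⟩ := re_eq_zero_and_im_eq_zero_of_symmetric conj_cfourier_neg_conj
    (differentiable_tprod_E₁ hs0 hs2.le hsum ha) (by simp [E₁_zero])
    (hasDerivAt_tprod_E₁_zero hs0 hs2.le hsum ha) hab
    (C := 3 * ∑' j : ZeroIndex (cfourier π), 1 / ‖zero (cfourier π) j‖ ^ s) (by positivity) hs2
    fun z => (hPs z).trans (by gcongr; linarith)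
  have ha' : a = Complex.I * (a.im : ℂ) := by
    apply Complex.ext <;> simp [hare]
  have hb' : b = (b.re : ℂ) := by
    apply Complex.ext <;> simp [hbim]
  have hb : b.re ≤ 0 := quadratic_coeff_nonpos (f := cfourier π) (p := a.im)
    (two_le_norm_cfourier_add hπ.nonneg hπ.integrable hπ.integral_eq_one hc hK)
    (fun z => by rw [← ha', ← hb']; exact hab z) hs2 hPs
  refine ⟨a.im, -b.re, by linarith, fun z => ⟨multipliable_E₁ hs0 hs2.le hsum ha z, ?_⟩⟩
  rw [hab z]
  congr 2
  rw [Complex.ofReal_neg, neg_neg, ← ha', ← hb', add_comm]
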